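/- Let $H$ be a separable complex Hilbert space and let $S \subset \widetilde S$ be closed, densely defined, symmetric operators in $H$ such that $\widetilde S$ has a positive lower bound, i.e. there is $\mu > 0$ with $(\widetilde S f, f) \ge \mu \|f\|^2$ for all $f \in \operatorname{dom} \widetilde S$. Assume that the embedding of $\operatorname{dom} \widetilde S$, equipped with the norm $\|f\|_{\widetilde S} := \|\widetilde S f\|$, into $H$ is compact. Let $S_{\rm K}$ and $\widetilde S_{\rm K}$ be the Krein--von Neumann extensions of $S$ and $\widetilde S$, i.e. $S_{\rm K} f = S^* f$ on $\operatorname{dom} S_{\rm K} = \operatorname{dom} S \dotplus \ker S^*$, and analogously for $\widetilde S_{\rm K}$. Then the spectra $\sigma(S_{\rm K})$ and $\sigma(\widetilde S_{\rm K})$ are contained in $[0, \infty)$ and consist of isolated eigenvalues, and the positive eigenvalues of $S_{\rm K}$ and of $\widetilde S_{\rm K}$ have finite multiplicities. In particular, for $A \in \{S_{\rm K}, \widetilde S_{\rm K}\}$ the positive eigenvalues of $A$ can be listed, counted with multiplicities, as $\lambda_1^+(A) \le \lambda_2^+(A) \le \dots$; if $\dim H = \infty$ this list is infinite, and if it is finite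 it is continued by the value $+\infty$. If, in addition, $\operatorname{dom} S$ has finite codimension $k \ge 0$ in $\operatorname{dom} \widetilde S$, then $$\lambda_j^+(\widetilde S_{\rm K}) \le \lambda_j^+(S_{\rm K}) \le \lambda_{j+k}^+(\widetilde S_{\rm K}) \le \lambda_{j+k}^+(S_{\rm K}) \qquad \text{for all } j = 1, 2, \dots$$ -/

import Mathlib

open Topology

namespace KreinVN

variable {H : Type*} [NormedAddCommGroup H] [InnerProductSpace ℂ H]

/-- The eigenspace `{x ∈ dom A | A x = z x}` of an (unbounded) operator `A` in `H`,
as a subspace of `H`. -/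
def eigenspace (A : H →ₗ.[ℂ] H) (z : ℂ) : Submodule ℂ H :=
  (LinearMap.ker (A.toFun - z • A.domain.subtype)).map A.domain.subtype

/-- The kernel `{x ∈ dom A | A x = 0}` of `A`, as a subspace of `H`. -/
def kernel (A : H →ₗ.[ℂ] H) : Submodule ℂ H :=
  (LinearMap.ker A.toFun).map A.domain.subtype

theorem mem_eigenspace_iff {A : H →ₗ.[ℂ] H} {z : ℂ} {x : H} :
    x ∈ eigenspace A z ↔ ∃ h : x ∈ A.domain, A ⟨x, h⟩ = z • x := by
  simp only [eigenspace, Submodule.mem_map, LinearMap.mem_ker, LinearMap.sub_apply, sub_eq_zero]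
  constructor
  · rintro ⟨y, hy, rfl⟩
    exact ⟨y.2, hy⟩
  · rintro ⟨h, hx⟩
    exact ⟨⟨x, h⟩, hx, rfl⟩

theorem mem_kernel_iff {A : H →ₗ.[ℂ] H} {x : H} :
    x ∈ kernel A ↔ ∃ h : x ∈ A.domain, A ⟨x, h⟩ = 0 := by
  simp only [kernel, Submodule.mem_map, LinearMap.mem_ker]
  constructor
  · rintro ⟨y, hy, rfl⟩
    exact ⟨y.2, hy⟩
  · rintro ⟨h, hx⟩
    exact ⟨⟨x, h⟩, hx, rfl⟩

/-- The resolvent set of `A`: those `z` for which `A - z : dom A → H` has an everywhere defined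
bounded two-sided inverse `R`. -/
def resolventSet (A : H →ₗ.[ℂ] H) : Set ℂ :=
  {z | ∃ R : H →L[ℂ] H,
    (∀ y : H, ∃ h : R y ∈ A.domain, A ⟨R y, h⟩ - z • R y = y) ∧
    ∀ x : A.domain, R (A x - z • (x : H)) = x}

/-- The spectrum of `A`, the complement of its resolvent set. -/
def spectrum (A : H →ₗ.[ℂ] H) : Set ℂ := (resolventSet A)ᶜ

/-- The spectrum of `A` is contained in `[0, ∞)` and consists of isolated eigenvalues, and the
positive eigenvalues of `A` have finite multiplicities. -/
structure HasDiscreteNonnegSpectrum (A : H →ₗ.[ℂ] H) : Prop where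
  nonneg : ∀ z ∈ spectrum A, 0 ≤ z.re ∧ z.im = 0
  isolated : ∀ z ∈ spectrum A, ∃ U ∈ 𝓝 z, U ∩ spectrum A = {z}
  eigenvalue : ∀ z ∈ spectrum A, eigenspace A z ≠ ⊥
  finite_multiplicity : ∀ r : ℝ, 0 < r → FiniteDimensional ℂ (eigenspace A (r : ℂ))

/-- `lam` lists all positive eigenvalues of `A` in nondecreasing order, each repeated according to
its multiplicity (the dimension of its eigenspace). Indices start at `0`, so `lam j` is
the `(j + 1)`-st positive eigenvalue. If there are only finitely many positive eigenvalues
(e.g. if `H` is finite-dimensional), the list is continued by the value `⊤ = +∞`. -/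
structure IsPosEigenvalueSeq (A : H →ₗ.[ℂ] H) (lam : ℕ → EReal) : Prop where
  mono : Monotone lam
  pos : ∀ j, 0 < lam j
  multiplicity : ∀ r : ℝ, 0 < r →
    {j | lam j = (r : EReal)}.encard = Cardinal.toENat (Module.rank ℂ (eigenspace A (r : ℂ)))

/-- The space `H_S`: the domain of `S`, carrying the norm `‖f‖_S = ‖S f‖`. (For general `S` this
is a seminorm; it is a norm when `S` has a positive lower bound.) -/
def DomSpace (S : H →ₗ.[ℂ] H) : Type _ := S.domain

instance (S : H →ₗ.[ℂ] H) : AddCommGroup (DomSpace S) :=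
  inferInstanceAs (AddCommGroup S.domain)

instance (S : H →ₗ.[ℂ] H) : Module ℂ (DomSpace S) :=
  inferInstanceAs (Module ℂ S.domain)

noncomputable instance (S : H →ₗ.[ℂ] H) : SeminormedAddCommGroup (DomSpace S) :=
  SeminormedAddCommGroup.induced (DomSpace S) H (show DomSpace S →ₗ[ℂ] H from S.toFun)

/-- The embedding `H_S → H`. -/
def embedding (S : H →ₗ.[ℂ] H) : DomSpace S →ₗ[ℂ] H := S.domain.subtype

theorem norm_domSpace (S : H →ₗ.[ℂ] H) (f : S.domain) :
    ‖(show DomSpace S from f)‖ = ‖S f‖ := rfl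

/-- `S` has a positive lower bound: `(S f, f) ≥ m ‖f‖²` on `dom S` for some `m > 0`. (The
inner product on the left is real when `S` is symmetric.) -/
def HasPositiveLowerBound (S : H →ₗ.[ℂ] H) : Prop :=
  ∃ m : ℝ, 0 < m ∧ ∀ f : S.domain, m * ‖(f : H)‖ ^ 2 ≤ (inner ℂ (S f) (f : H)).re

variable [CompleteSpace H]

/-- The Krein–von Neumann extension of `S`: the restriction of the adjoint `S*` to
`dom S + ker S*`. -/
noncomputable def kreinExtension (S : H →ₗ.[ℂ] H) : H →ₗ.[ℂ] H :=
  S.adjoint.domRestrict (S.domain ⊔ kernel S.adjoint)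

theorem kreinExtension_le_adjoint (S : H →ₗ.[ℂ] H) : kreinExtension S ≤ S.adjoint :=
  LinearPMap.domRestrict_le

theorem kreinExtension_domain {S : H →ₗ.[ℂ] H} (hd : Dense (S.domain : Set H))
    (hs : S.IsFormalAdjoint S) :
    (kreinExtension S).domain = S.domain ⊔ kernel S.adjoint := by
  rw [kreinExtension, LinearPMap.domRestrict_domain, inf_eq_left]
  refine sup_le (LinearPMap.IsFormalAdjoint.le_adjoint hd hs).1 fun x hx => ?_
  exact (mem_kernel_iff.1 hx).1

theorem disjoint_domain_kernel {S : H →ₗ.[ℂ] H} (hd : Dense (S.domain : Set H))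
    (hs : S.IsFormalAdjoint S) (hp : HasPositiveLowerBound S) :
    Disjoint S.domain (kernel S.adjoint) := by
  rw [Submodule.disjoint_def]
  intro x hx hk
  obtain ⟨m, hm, hb⟩ := hp
  obtain ⟨h, h0⟩ := mem_kernel_iff.1 hk
  have h1 : S ⟨x, hx⟩ = 0 := by
    rw [(LinearPMap.IsFormalAdjoint.le_adjoint hd hs).2 (x := ⟨x, hx⟩) (y := ⟨x, h⟩) rfl, h0]
  have h2 := hb ⟨x, hx⟩
  rw [h1] at h2
  simp only [inner_zero_left, Complex.zero_re] at h2
  have h3 : ‖x‖ ^ 2 ≤ 0 := by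
    by_contra hc
    have := mul_pos hm (not_le.1 hc)
    linarith
  have h4 : ‖x‖ = 0 := by
    have := le_antisymm h3 (sq_nonneg _)
    simpa using this
  exact norm_eq_zero.1 h4

end KreinVN

/-! The lower bound makes `S` injective with closed range, so ker `S*` is the orthogonal complement
of ran `S`. Let `P` be the projection onto ran `S` and `G` the operator `S⁻¹P`, which is compact
because it factors through the compact embedding of dom `S`. The compression `B = PG` is compact,
symmetric and nonnegative. If `S_K(g + h) = S g = z(g + h)` with `z ≠ 0`, then `g + h` lies in ran
`S`, so `P g = g + h` and `B (S g) = z⁻¹ S g`; hence the eigenspace of `S_K` at `z` is that of `B`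
at `z⁻¹` (`eigenspace_kreinExtension`). The resolvent of `S_K` is likewise expressed through that of
`B`, so the spectral claims follow from the theory of compact operators; only `0` may have infinite
multiplicity.

For the inequalities, the number of eigenvalues of `S_K` in `(0, r]` is the largest dimension of a
subspace of dom `S` on which `‖S g‖² ≤ r (S g, g)`: put `u = S g` in the min-max principle for `B`,
where `(u, B u) = (S g, g)` (`finrank_le_upperEigenspan`, `exists_finrank_eq_upperEigenspan`). This
quantity sees only `S` on its domain. It grows when `S` is extended, and by at most `k` when the
codimension is `k`. Comparing counting functions is the same as comparing the ordered lists
(`le_shift_of_posCount_le`). -/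

/-! ### Counting functions and nondecreasing lists -/

section Counting

/-- The sum of the multiplicities `m s` over all `s ∈ (0, R]`. -/
noncomputable def posCount (m : ℝ → ℕ) (R : ℝ) : ℕ := ∑ᶠ s ∈ Set.Ioc 0 R, m s

variable {m : ℝ → ℕ}

theorem posCount_eq_sum (hm : ∀ R, (Set.Ioc 0 R ∩ m.support).Finite) (R : ℝ) :
    posCount m R = ∑ s ∈ (hm R).toFinset, m s := by
  rw [posCount, ← finsum_mem_inter_support, finsum_mem_eq_finite_toFinset_sum _ (hm R)]

theorem encard_le_eq_posCount (hm : ∀ R, (Set.Ioc 0 R ∩ m.support).Finite) {lam : ℕ → EReal}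
    (hpos : ∀ j, 0 < lam j) (hmul : ∀ r : ℝ, 0 < r → {j | lam j = (r : EReal)}.encard = m r)
    (R : ℝ) : {j | lam j ≤ (R : EReal)}.encard = posCount m R := by
  have key : ∀ t : Finset ℝ, (∀ s ∈ t, 0 < s) →
      {j | ∃ s ∈ t, lam j = (s : EReal)}.encard = ((∑ s ∈ t, m s : ℕ) : ℕ∞) := by
    intro t
    induction t using Finset.induction_on with
    | empty => simp
    | insert a t ha ih =>
      intro ht
      have h1 : {j | ∃ s ∈ insert a t, lam j = (s : EReal)} =
          {j | lam j = (a : EReal)} ∪ {j | ∃ s ∈ t, lam j = (s : EReal)} := by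
        ext j; simp
      rw [h1, Set.encard_union_eq, Finset.sum_insert ha, hmul a (ht a (by simp)),
        ih fun s hs => ht s (by simp [hs])]
      · push_cast; rfl
      · rw [Set.disjoint_left]
        rintro j hj ⟨s, hs, hjs⟩
        have : a = s := by
          have h2 : (a : EReal) = s := by rw [← hjs]; exact hj.symm
          exact_mod_cast h2
        exact ha (this ▸ hs)
  rw [posCount_eq_sum hm, ← key _ fun s hs => ((hm R).mem_toFinset.1 hs).1.1]
  congr 1
  ext j
  simp only [Set.mem_ofPred_eq, Set.Finite.mem_toFinset, Set.mem_inter_iff, Set.mem_Ioc,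
    Function.mem_support]
  constructor
  · intro hj
    have htop : lam j ≠ ⊤ := fun h => by simp [h] at hj
    have hbot : lam j ≠ ⊥ := fun h => by simpa [h] using hpos j
    obtain ⟨s, hs⟩ : ∃ s : ℝ, (s : EReal) = lam j := ⟨_, EReal.coe_toReal htop hbot⟩
    have hs0 : 0 < s := by have := hpos j; rw [← hs] at this; exact_mod_cast this
    refine ⟨s, ⟨⟨hs0, by rw [← hs] at hj; exact_mod_cast hj⟩, fun h0 => ?_⟩, hs.symm⟩
    have := hmul s hs0
    rw [h0, Nat.cast_zero, Set.encard_eq_zero] at this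
    exact (Set.mem_empty_iff_false j).1 (this ▸ hs.symm)
  · rintro ⟨s, ⟨⟨-, hs⟩, -⟩, hj⟩
    rw [hj]; exact_mod_cast hs

/-- By monotonicity the indices with `lam j ≤ R` form an initial segment of `ℕ`, of length `posCount
m R`; the inequality is strict because indices start at `0`. -/
theorem lt_posCount_of_le (hm : ∀ R, (Set.Ioc 0 R ∩ m.support).Finite) {lam : ℕ → EReal}
    (hmono : Monotone lam) (hpos : ∀ j, 0 < lam j)
    (hmul : ∀ r : ℝ, 0 < r → {j | lam j = (r : EReal)}.encard = m r)
    (R : ℝ) (j : ℕ) : lam j ≤ (R : EReal) ↔ j < posCount m R := by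
  have h := encard_le_eq_posCount hm hpos hmul R
  constructor
  · intro hj
    have hsub : ((Finset.range (j + 1) : Finset ℕ) : Set ℕ) ⊆ {j | lam j ≤ (R : EReal)} := by
      intro i hi
      have hi' : i ≤ j := by simpa [Nat.lt_succ_iff] using hi
      exact (hmono hi').trans hj
    have := Set.encard_le_encard hsub
    rw [h, Set.encard_coe_eq_coe_finsetCard, Finset.card_range] at this
    exact_mod_cast this
  · intro hj
    by_contra hc
    have hsub : {j | lam j ≤ (R : EReal)} ⊆ ((Finset.range j : Finset ℕ) : Set ℕ) := by
      intro i hi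
      by_contra hij
      have hij' : j ≤ i := by simpa using hij
      exact hc ((hmono hij').trans hi)
    have := Set.encard_le_encard hsub
    rw [h, Set.encard_coe_eq_coe_finsetCard, Finset.card_range] at this
    have : posCount m R ≤ j := by exact_mod_cast this
    omega

/-- A locally finite family of multiplicities on `(0, ∞)` can be listed in nondecreasing order. -/
theorem exists_monotone_list (hm : ∀ R, (Set.Ioc 0 R ∩ m.support).Finite) :
    ∃ lam : ℕ → EReal, Monotone lam ∧ (∀ j, 0 < lam j) ∧
      ∀ r : ℝ, 0 < r → {j | lam j = (r : EReal)}.encard = m r := by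
  classical
  -- Total multiplicity strictly below `R`. The value `s` is to occupy exactly the indices from
  -- `below s` up to, but not including, `posCount m s`.
  let below : ℝ → ℕ := fun R => ∑ s ∈ (hm R).toFinset with s < R, m s
  have mem : ∀ R s, s ∈ (hm R).toFinset ↔ (0 < s ∧ s ≤ R) ∧ m s ≠ 0 := by
    intro R s; simp [Function.mem_support]
  have hsplit : ∀ R, 0 < R → posCount m R = below R + m R := by
    intro R hR
    rw [posCount_eq_sum hm, ← Finset.sum_filter_add_sum_filter_not _ (fun s => s < R)]
    congr 1
    by_cases h0 : m R = 0
    · rw [h0]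
      refine Finset.sum_eq_zero fun s hs => ?_
      simp only [Finset.mem_filter, mem, not_lt] at hs
      rw [le_antisymm hs.1.1.2 hs.2, h0]
    · rw [← Finset.sum_singleton m R]
      congr 1
      ext s
      simp only [Finset.mem_filter, mem, not_lt, Finset.mem_singleton]
      constructor
      · rintro ⟨⟨⟨-, h1⟩, -⟩, h2⟩; exact le_antisymm h1 h2
      · rintro rfl; exact ⟨⟨⟨hR, le_rfl⟩, h0⟩, le_rfl⟩
  have hcount_le : ∀ s R, s < R → posCount m s ≤ below R := by
    intro s R hsR
    rw [posCount_eq_sum hm]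
    refine Finset.sum_le_sum_of_subset fun t ht => ?_
    rw [mem] at ht
    rw [Finset.mem_filter, mem]
    exact ⟨⟨⟨ht.1.1, ht.1.2.trans hsR.le⟩, ht.2⟩, ht.1.2.trans_lt hsR⟩
  have huniq : ∀ j s s', below s ≤ j → j < posCount m s → below s' ≤ j → j < posCount m s' →
      s = s' := by
    intro j s s' h1 h2 h3 h4
    rcases lt_trichotomy s s' with h | h | h
    · have := hcount_le _ _ h; omega
    · exact h
    · have := hcount_le _ _ h; omega
  have hpos : ∀ s j, j < posCount m s → 0 < s := by
    intro s j hj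
    by_contra hs
    rw [posCount_eq_sum hm, Finset.sum_eq_zero] at hj
    · omega
    · intro t ht
      rw [mem] at ht
      exact absurd (ht.1.1.trans_le ht.1.2) hs
  have hbelow : ∀ R j, j < below R → ∃ t ∈ (hm R).toFinset, t < R ∧ j < posCount m t := by
    intro R j hj
    have hne : ((hm R).toFinset.filter (· < R)).Nonempty := by
      rw [Finset.nonempty_iff_ne_empty]
      intro h
      simp [below, h] at hj
    have hmax := Finset.max'_mem _ hne
    refine ⟨_, (Finset.mem_filter.1 hmax).1, (Finset.mem_filter.1 hmax).2, hj.trans_le ?_⟩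
    rw [posCount_eq_sum hm]
    refine Finset.sum_le_sum_of_subset fun t ht => ?_
    have hle := Finset.le_max' _ t ht
    rw [Finset.mem_filter, mem] at ht
    rw [mem]
    exact ⟨⟨ht.1.1.1, hle⟩, ht.1.2⟩
  have hex : ∀ R j, j < posCount m R → ∃ s ≤ R, below s ≤ j ∧ j < posCount m s := by
    intro R j hj
    by_cases hR : below R ≤ j
    · exact ⟨R, le_rfl, hR, hj⟩
    obtain ⟨t, ht, htR, hjt⟩ := hbelow R j (not_le.1 hR)
    -- The value at index `j` is the least `s` in the support with `j < posCount m s`; minimality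
    -- gives `below s ≤ j`.
    have hne : ((hm R).toFinset.filter fun s => j < posCount m s).Nonempty :=
      ⟨t, Finset.mem_filter.2 ⟨ht, hjt⟩⟩
    have hmin := Finset.mem_filter.1 (Finset.min'_mem _ hne)
    set s := Finset.min' _ hne with hs
    have hsR := ((mem _ _).1 hmin.1).1.2
    refine ⟨s, hsR, ?_, hmin.2⟩
    by_contra hc
    obtain ⟨u, hu, hus, hju⟩ := hbelow s j (not_le.1 hc)
    have hu' := (mem _ _).1 hu
    have : s ≤ u := Finset.min'_le _ u
      (Finset.mem_filter.2 ⟨(mem _ _).2 ⟨⟨hu'.1.1, hu'.1.2.trans hsR⟩, hu'.2⟩, hju⟩)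
    exact absurd hus (not_lt.2 this)
  let lam : ℕ → EReal := fun j =>
    if h : ∃ s, below s ≤ j ∧ j < posCount m s then (h.choose : EReal) else ⊤
  have hlam : ∀ j r, lam j = ((r : ℝ) : EReal) ↔ below r ≤ j ∧ j < posCount m r := by
    intro j r
    by_cases h : ∃ s, below s ≤ j ∧ j < posCount m s
    · simp only [lam, dif_pos h, EReal.coe_eq_coe_iff]
      constructor
      · intro hr; rw [← hr]; exact h.choose_spec
      · intro hr
        exact huniq j _ _ h.choose_spec.1 h.choose_spec.2 hr.1 hr.2
    · simp only [lam, dif_neg h, EReal.top_ne_coe, false_iff]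
      exact fun hr => h ⟨r, hr⟩
  have hcases : ∀ j, lam j = ⊤ ∨ ∃ s : ℝ, lam j = s := by
    intro j
    by_cases h : ∃ s, below s ≤ j ∧ j < posCount m s
    · exact .inr ⟨h.choose, by simp only [lam, dif_pos h]⟩
    · exact .inl (by simp only [lam, dif_neg h])
  refine ⟨lam, ?_, ?_, ?_⟩
  · intro i j hij
    rcases hcases j with h | ⟨s, h⟩
    · rw [h]; exact le_top
    · obtain ⟨-, h2⟩ := (hlam _ _).1 h
      obtain ⟨t, ht, h3⟩ := hex s i (by omega)
      rw [h, (hlam i t).2 h3]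
      exact_mod_cast ht
  · intro j
    rcases hcases j with h | ⟨s, h⟩
    · rw [h]; exact EReal.zero_lt_top
    · rw [h]; exact_mod_cast hpos s j ((hlam _ _).1 h).2
  · intro r hr
    have : {j | lam j = (r : EReal)} =
        ((Finset.Ico (below r) (posCount m r) : Finset ℕ) : Set ℕ) := by
      ext j; simp [hlam]
    rw [this, Set.encard_coe_eq_coe_finsetCard, Nat.card_Ico, hsplit r hr, Nat.add_sub_cancel_left]

/-- If one list has at most `k` more members in every `(0, R]` than another one, then it is
bounded below by it up to a shift by `k`. -/
theorem le_shift_of_posCount_le {m' : ℝ → ℕ} (hm : ∀ R, (Set.Ioc 0 R ∩ m.support).Finite)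
    (hm' : ∀ R, (Set.Ioc 0 R ∩ m'.support).Finite) {lam lam' : ℕ → EReal}
    (hmono : Monotone lam) (hpos : ∀ j, 0 < lam j)
    (hmul : ∀ r : ℝ, 0 < r → {j | lam j = (r : EReal)}.encard = m r)
    (hmono' : Monotone lam') (hpos' : ∀ j, 0 < lam' j)
    (hmul' : ∀ r : ℝ, 0 < r → {j | lam' j = (r : EReal)}.encard = m' r) {k : ℕ}
    (hk : ∀ R, 0 < R → posCount m' R ≤ posCount m R + k) (j : ℕ) : lam j ≤ lam' (j + k) := by
  by_cases htop : lam' (j + k) = ⊤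
  · rw [htop]; exact le_top
  have hbot : lam' (j + k) ≠ ⊥ := fun h => by simpa [h] using hpos' (j + k)
  obtain ⟨s, hs⟩ : ∃ s : ℝ, (s : EReal) = lam' (j + k) := ⟨_, EReal.coe_toReal htop hbot⟩
  have hs0 : 0 < s := by have := hpos' (j + k); rw [← hs] at this; exact_mod_cast this
  rw [← hs, lt_posCount_of_le hm hmono hpos hmul]
  have := (lt_posCount_of_le hm' hmono' hpos' hmul' s (j + k)).1 hs.symm.le
  have := hk s hs0
  omega

end Counting

/-! ### Compact symmetric operators -/

section CompactSymmetric

variable {H : Type*} [NormedAddCommGroup H] [InnerProductSpace ℂ H]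

theorem Submodule.finrank_finset_sup_of_iSupIndep {ι K V : Type*} [DivisionRing K]
    [AddCommGroup V] [Module K V] {p : ι → Submodule K V} (hp : iSupIndep p) (t : Finset ι)
    (hfin : ∀ i ∈ t, FiniteDimensional K (p i)) :
    FiniteDimensional K ↥(t.sup p) ∧
      Module.finrank K ↥(t.sup p) = ∑ i ∈ t, Module.finrank K (p i) := by
  classical
  induction t using Finset.induction_on with
  | empty => rw [Finset.sup_empty]; exact ⟨inferInstance, by simp⟩
  | insert a t ha ih =>
    obtain ⟨h1, h2⟩ := ih fun i hi => hfin i (Finset.mem_insert_of_mem hi)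
    have h3 := hfin a (Finset.mem_insert_self a t)
    have hdisj : Disjoint (p a) (t.sup p) :=
      (hp.supIndep' (insert a t)) (Finset.subset_insert a t) (Finset.mem_insert_self a t) ha
    rw [Finset.sup_insert, Finset.sum_insert ha, ← h2]
    refine ⟨inferInstance, ?_⟩
    have := Submodule.finrank_sup_add_finrank_inf_eq (p a) (t.sup p)
    rwa [hdisj.eq_bot, finrank_bot, add_zero] at this

/-- The sum of the eigenspaces of `B` for the eigenvalues `s⁻¹` with `0 < s ≤ R`. -/
noncomputable def upperEigenspan (B : H →L[ℂ] H) (R : ℝ) : Submodule ℂ H :=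
  ⨆ s : Set.Ioc (0 : ℝ) R, Module.End.eigenspace (B : Module.End ℂ H) (((s : ℝ) : ℂ)⁻¹)

variable {B : H →L[ℂ] H}

theorem eigenspace_le_upperEigenspan {s R : ℝ} (hs : 0 < s) (hsR : s ≤ R) :
    Module.End.eigenspace (B : Module.End ℂ H) ((s : ℂ)⁻¹) ≤ upperEigenspan B R :=
  le_iSup (fun s : Set.Ioc (0 : ℝ) R =>
    Module.End.eigenspace (B : Module.End ℂ H) (((s : ℝ) : ℂ)⁻¹)) ⟨s, hs, hsR⟩

theorem inv_ofReal_injective : Function.Injective fun s : ℝ => (s : ℂ)⁻¹ :=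
  inv_injective.comp Complex.ofReal_injective

/-- Eigenspaces are mutually orthogonal, so the form is a sum of terms `s⁻¹‖f s‖²`, each with `s⁻¹ ≥
R⁻¹`. -/
theorem inv_mul_norm_sq_le_of_mem_upperEigenspan (hB : (B : H →ₗ[ℂ] H).IsSymmetric) {R : ℝ}
    {u : H} (hu : u ∈ upperEigenspan B R) : R⁻¹ * ‖u‖ ^ 2 ≤ (inner ℂ u (B u)).re := by
  classical
  have horth := hB.orthogonalFamily_eigenspaces.comp (γ := Set.Ioc (0 : ℝ) R)
    (f := fun s => ((s : ℝ) : ℂ)⁻¹) (inv_ofReal_injective.comp Subtype.coe_injective)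
  obtain ⟨f, rfl⟩ := (Submodule.mem_iSup_iff_exists_dfinsupp' _ _).1 hu
  have h1 : (f.sum fun _ x => (x : H)) = ∑ s ∈ f.support,
      (Module.End.eigenspace (B : H →ₗ[ℂ] H) (((s : ℝ) : ℂ)⁻¹)).subtypeₗᵢ (f s) := rfl
  have h2 : B (f.sum fun _ x => (x : H)) = ∑ s ∈ f.support,
      (Module.End.eigenspace (B : H →ₗ[ℂ] H) (((s : ℝ) : ℂ)⁻¹)).subtypeₗᵢ
        ((((s : ℝ) : ℂ)⁻¹) • f s) := by
    rw [h1, map_sum]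
    refine Finset.sum_congr rfl fun s _ => ?_
    exact Module.End.mem_eigenspace_iff.1 (f s).2
  rw [h2, h1, horth.norm_sum, horth.inner_sum, Complex.re_sum, Finset.mul_sum]
  refine Finset.sum_le_sum fun s _ => ?_
  rw [inner_smul_right, inner_self_eq_norm_sq_to_K]
  have : ((((s : ℝ) : ℂ)⁻¹) * ((‖f s‖ : ℝ) : ℂ) ^ 2).re = (s : ℝ)⁻¹ * ‖f s‖ ^ 2 := by
    norm_cast
  refine le_of_le_of_eq ?_ this.symm
  exact mul_le_mul_of_nonneg_right (inv_anti₀ s.2.1 s.2.2) (sq_nonneg _)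

/-- The form bound and Cauchy–Schwarz give `‖v‖ ≤ R ‖B v‖` on this space, so compactness of `B`
makes a neighbourhood of `0` totally bounded. -/
theorem finiteDimensional_upperEigenspan (hB : (B : H →ₗ[ℂ] H).IsSymmetric)
    (hc : IsCompactOperator B) (R : ℝ) : FiniteDimensional ℂ (upperEigenspan B R) := by
  rcases le_or_gt R 0 with hR | hR
  · have : IsEmpty (Set.Ioc (0 : ℝ) R) := by rw [Set.Ioc_eq_empty (not_lt.2 hR)]; infer_instance
    rw [upperEigenspan, iSup_of_empty]
    infer_instance
  set V := upperEigenspan B R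
  let f : V →L[ℂ] H := B ∘L V.subtypeL
  have hbound : ∀ v : V, ‖v‖ ≤ (⟨R, hR.le⟩ : NNReal) * ‖f v‖ := by
    intro v
    have h1 := inv_mul_norm_sq_le_of_mem_upperEigenspan hB v.2
    have h2 : (inner ℂ (v : H) (B v)).re ≤ ‖(v : H)‖ * ‖B v‖ := re_inner_le_norm (𝕜 := ℂ) _ _
    have h3 : ‖(v : H)‖ ≤ R * ‖B v‖ := by
      by_cases h0 : ‖(v : H)‖ = 0
      · rw [h0]; positivity
      have h0' : 0 < ‖(v : H)‖ := lt_of_le_of_ne (norm_nonneg _) (Ne.symm h0)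
      have h4 : ‖(v : H)‖ * (R⁻¹ * ‖(v : H)‖) ≤ ‖(v : H)‖ * ‖B v‖ := by
        calc _ = R⁻¹ * ‖(v : H)‖ ^ 2 := by ring
          _ ≤ _ := h1.trans h2
      have h5 := le_of_mul_le_mul_left h4 h0'
      rwa [inv_mul_le_iff₀ hR] at h5
    exact h3
  have hanti : AntilipschitzWith ⟨R, hR.le⟩ f := AddMonoidHomClass.antilipschitz_of_bound f hbound
  obtain ⟨K, hK, hKn⟩ := hc.comp_clm V.subtypeL
  refine FiniteDimensional.of_totallyBounded_nhds_zero ℂ hKn ?_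
  exact totallyBounded_preimage (hanti.isUniformInducing f.uniformContinuous) hK.totallyBounded

variable [CompleteSpace H]

/-- The norm of a self-adjoint operator is attained in its spectrum, and nonzero spectrum of a
compact operator consists of eigenvalues. Attainment is what keeps the inequality strict. -/
theorem norm_lt_of_forall_hasEigenvalue (hB : (B : H →ₗ[ℂ] H).IsSymmetric)
    (hc : IsCompactOperator B) {c : ℝ} (hc0 : 0 < c)
    (h : ∀ μ, Module.End.HasEigenvalue (B : Module.End ℂ H) μ → ‖μ‖ < c) : ‖B‖ < c := by
  rcases subsingleton_or_nontrivial H with hH | hH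
  · rwa [Subsingleton.elim B 0, norm_zero]
  obtain ⟨k, hk, hkB⟩ := spectrum.exists_nnnorm_eq_spectralRadius B
  rw [B.spectralRadius_eq_nnnorm hB.isSelfAdjoint] at hkB
  have hkB' : ‖k‖ = ‖B‖ := by
    rw [← coe_nnnorm, ← coe_nnnorm]; exact_mod_cast hkB
  rw [← hkB']
  by_cases hk0 : k = 0
  · rwa [hk0, norm_zero]
  · exact h k ((hc.hasEigenvalue_iff_mem_spectrum hk0).2 hk)

theorem inner_lt_inv_mul_norm_sq_of_mem_orthogonal (hB : (B : H →ₗ[ℂ] H).IsSymmetric)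
    (hc : IsCompactOperator B) (hpos : ∀ x, 0 ≤ (inner ℂ x (B x)).re) {R : ℝ} (hR : 0 < R)
    {u : H} (hu : u ∈ (upperEigenspan B R)ᗮ) (hu0 : u ≠ 0) :
    (inner ℂ u (B u)).re < R⁻¹ * ‖u‖ ^ 2 := by
  set W := (upperEigenspan B R)ᗮ with hW
  have hinv : ∀ v ∈ W, B v ∈ W := by
    intro v hv
    rw [hW, upperEigenspan, ← Submodule.iInf_orthogonal, Submodule.mem_iInf] at hv ⊢
    exact fun s => hB.invariant_orthogonalComplement_eigenspace _ v (hv s)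
  let A : W →L[ℂ] W := B.restrict hinv
  have hAc : IsCompactOperator A := hc.restrict' hinv
  have hA : (A : W →ₗ[ℂ] W).IsSymmetric := hB.restrict_invariant hinv
  have hlt : ‖A‖ < R⁻¹ := by
    refine norm_lt_of_forall_hasEigenvalue hA hAc (inv_pos.2 hR) fun μ hμ => ?_
    obtain ⟨v, hv, hv0⟩ := hμ.exists_hasEigenvector
    have hreal : ((μ.re : ℝ) : ℂ) = μ := Complex.conj_eq_iff_re.1 (hA.conj_eigenvalue_eq_self hμ)
    have hBv : B (v : H) = μ • (v : H) := congrArg Subtype.val (Module.End.mem_eigenspace_iff.1 hv)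
    have hv0' : (v : H) ≠ 0 := fun h => hv0 (Subtype.ext h)
    have hn : 0 < ‖(v : H)‖ ^ 2 := by positivity
    have hμ0 : 0 ≤ μ.re := by
      have := hpos v
      rw [hBv, inner_smul_right, inner_self_eq_norm_sq_to_K, ← hreal] at this
      have h2 : (((μ.re : ℝ) : ℂ) * ((‖(v : H)‖ : ℝ) : ℂ) ^ 2).re = μ.re * ‖(v : H)‖ ^ 2 := by
        norm_cast
      have h3 : 0 ≤ μ.re * ‖(v : H)‖ ^ 2 := h2 ▸ this
      exact nonneg_of_mul_nonneg_left h3 hn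
    rw [← hreal, Complex.norm_real, Real.norm_of_nonneg hμ0]
    -- An eigenvector of the restriction with eigenvalue at least `R⁻¹` would lie in `upperEigenspan
    -- B R` and in its orthogonal complement.
    by_contra hcon
    rw [not_lt] at hcon
    have hμpos : 0 < μ.re := (inv_pos.2 hR).trans_le hcon
    have hmem : (v : H) ∈ upperEigenspan B R := by
      refine eigenspace_le_upperEigenspan (inv_pos.2 hμpos) (inv_le_of_inv_le₀ hR hcon) ?_
      rw [Complex.ofReal_inv, inv_inv, hreal]
      exact Module.End.mem_eigenspace_iff.2 hBv
    exact hv0' (inner_self_eq_zero.1 (v.2 _ hmem))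
  have hn : 0 < ‖u‖ ^ 2 := by positivity
  calc (inner ℂ u (B u)).re ≤ ‖u‖ * ‖B u‖ := re_inner_le_norm (𝕜 := ℂ) _ _
    _ ≤ ‖u‖ * (‖A‖ * ‖u‖) :=
        mul_le_mul_of_nonneg_left (A.le_opNorm ⟨u, hu⟩) (norm_nonneg _)
    _ = ‖A‖ * ‖u‖ ^ 2 := by ring
    _ < R⁻¹ * ‖u‖ ^ 2 := mul_lt_mul_of_pos_right hlt hn

end CompactSymmetric

/-! ### Counting eigenvalues by dimension -/

section EigenvalueCounting

variable {H : Type*} [NormedAddCommGroup H] [InnerProductSpace ℂ H] {B : H →L[ℂ] H}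

theorem finiteDimensional_eigenspace_inv (hB : (B : H →ₗ[ℂ] H).IsSymmetric)
    (hc : IsCompactOperator B) {s : ℝ} (hs : 0 < s) :
    FiniteDimensional ℂ (Module.End.eigenspace (B : Module.End ℂ H) ((s : ℂ)⁻¹)) := by
  have := finiteDimensional_upperEigenspan hB hc s
  exact Submodule.finiteDimensional_of_le (eigenspace_le_upperEigenspan hs le_rfl)

theorem sum_finrank_eigenspace_inv (hB : (B : H →ₗ[ℂ] H).IsSymmetric)
    (hc : IsCompactOperator B) (t : Finset ℝ) (ht : ∀ s ∈ t, 0 < s) :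
    ∑ s ∈ t, Module.finrank ℂ (Module.End.eigenspace (B : Module.End ℂ H) ((s : ℂ)⁻¹)) =
      Module.finrank ℂ ↥(t.sup fun s : ℝ =>
        Module.End.eigenspace (B : Module.End ℂ H) ((s : ℂ)⁻¹)) :=
  (Submodule.finrank_finset_sup_of_iSupIndep
    ((Module.End.eigenspaces_iSupIndep (B : Module.End ℂ H)).comp inv_ofReal_injective) t
    fun s hs => finiteDimensional_eigenspace_inv hB hc (ht s hs)).2.symm

theorem finite_support_finrank_eigenspace_inv (hB : (B : H →ₗ[ℂ] H).IsSymmetric)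
    (hc : IsCompactOperator B) (R : ℝ) : (Set.Ioc 0 R ∩ Function.support fun s : ℝ =>
      Module.finrank ℂ (Module.End.eigenspace (B : Module.End ℂ H) ((s : ℂ)⁻¹))).Finite := by
  have hfin := finiteDimensional_upperEigenspan hB hc R
  by_contra hinf
  -- One more distinct eigenvalue than the dimension of the span contradicts independence of the
  -- eigenspaces.
  obtain ⟨t, hts, htc⟩ := Set.Infinite.exists_subset_card_eq hinf
    (Module.finrank ℂ (upperEigenspan B R) + 1)
  have h1 := sum_finrank_eigenspace_inv hB hc t fun s hs => (hts hs).1.1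
  have h2 : (t.sup fun s : ℝ => Module.End.eigenspace (B : Module.End ℂ H) ((s : ℂ)⁻¹)) ≤
      upperEigenspan B R :=
    Finset.sup_le fun s hs => eigenspace_le_upperEigenspan (hts hs).1.1 (hts hs).1.2
  have h3 := Submodule.finrank_mono h2
  have h4 := Finset.card_nsmul_le_sum t (fun s : ℝ =>
    Module.finrank ℂ (Module.End.eigenspace (B : Module.End ℂ H) ((s : ℂ)⁻¹))) 1
    fun s hs => Nat.one_le_iff_ne_zero.2 (hts hs).2
  rw [htc, smul_eq_mul, mul_one] at h4
  omega

theorem posCount_finrank_eigenspace_inv (hB : (B : H →ₗ[ℂ] H).IsSymmetric)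
    (hc : IsCompactOperator B) (R : ℝ) : posCount (fun s : ℝ =>
      Module.finrank ℂ (Module.End.eigenspace (B : Module.End ℂ H) ((s : ℂ)⁻¹))) R =
        Module.finrank ℂ (upperEigenspan B R) := by
  have hfin := finite_support_finrank_eigenspace_inv hB hc
  rw [posCount_eq_sum hfin, sum_finrank_eigenspace_inv hB hc _
    fun s hs => ((hfin R).mem_toFinset.1 hs).1.1]
  refine congrArg (fun V : Submodule ℂ H => Module.finrank ℂ V)
    (le_antisymm (Finset.sup_le fun s hs => ?_) (iSup_le fun s => ?_))
  · have := ((hfin R).mem_toFinset.1 hs).1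
    exact eigenspace_le_upperEigenspan this.1 this.2
  · by_cases h0 : Module.finrank ℂ
        (Module.End.eigenspace (B : Module.End ℂ H) (((s : ℝ) : ℂ)⁻¹)) = 0
    · have := finiteDimensional_eigenspace_inv hB hc s.2.1
      rw [Submodule.finrank_eq_zero.1 h0]
      exact bot_le
    · exact Finset.le_sup (f := fun s : ℝ =>
        Module.End.eigenspace (B : Module.End ℂ H) ((s : ℂ)⁻¹))
        ((hfin R).mem_toFinset.2 ⟨s.2, h0⟩)

end EigenvalueCounting

/-! ### Consequences of the lower bound and restriction -/

namespace KreinVN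

section Restriction

variable {H : Type*} [NormedAddCommGroup H] [InnerProductSpace ℂ H] {S T : H →ₗ.[ℂ] H}

theorem HasPositiveLowerBound.mono (hST : S ≤ T) (hT : HasPositiveLowerBound T) :
    HasPositiveLowerBound S := by
  obtain ⟨m, hm, h⟩ := hT
  refine ⟨m, hm, fun f => ?_⟩
  rw [hST.2 (x := f) (y := ⟨f, hST.1 f.2⟩) rfl]
  exact h ⟨f, hST.1 f.2⟩

theorem isCompactOperator_embedding_mono (hST : S ≤ T)
    (hT : IsCompactOperator (embedding T)) : IsCompactOperator (embedding S) := by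
  -- The inclusion is isometric, since `S` and `T` agree on dom `S`; a compact neighbourhood
  -- condition pulls back along it.
  let i : DomSpace S →+ DomSpace T := (Submodule.inclusion hST.1).toAddMonoidHom
  have hi : Continuous i := by
    refine AddMonoidHomClass.continuous_of_bound i 1 fun f => ?_
    have : ‖i f‖ = ‖f‖ := by
      change ‖T _‖ = ‖S _‖
      rw [hST.2 (x := f) (y := Submodule.inclusion hST.1 f) rfl]; rfl
    rw [this, one_mul]
  obtain ⟨K, hK, hKn⟩ := hT
  refine ⟨K, hK, ?_⟩
  have := hi.tendsto 0
  rw [map_zero] at this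
  exact this hKn

theorem HasPositiveLowerBound.exists_norm_le (hS : HasPositiveLowerBound S) :
    ∃ m : ℝ, 0 < m ∧ ∀ f : S.domain, m * ‖(f : H)‖ ≤ ‖S f‖ := by
  obtain ⟨m, hm, h⟩ := hS
  refine ⟨m, hm, fun f => ?_⟩
  by_cases h0 : ‖(f : H)‖ = 0
  · rw [h0, mul_zero]; exact norm_nonneg _
  have h0' : 0 < ‖(f : H)‖ := lt_of_le_of_ne (norm_nonneg _) (Ne.symm h0)
  refine le_of_mul_le_mul_right ?_ h0'
  calc m * ‖(f : H)‖ * ‖(f : H)‖ = m * ‖(f : H)‖ ^ 2 := by ring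
    _ ≤ _ := h f
    _ ≤ _ := re_inner_le_norm (𝕜 := ℂ) _ _

/-- The range is the image of the complete graph under the second projection, which the lower bound
makes antilipschitz. -/
theorem isClosed_range_of_hasPositiveLowerBound [CompleteSpace H] (hc : S.IsClosed)
    (hS : HasPositiveLowerBound S) : IsClosed (LinearMap.range S.toFun : Set H) := by
  obtain ⟨m, hm, hb⟩ := hS.exists_norm_le
  have hcomp : CompleteSpace S.graph := hc.completeSpace_coe
  let f : S.graph →L[ℂ] H := (ContinuousLinearMap.snd ℂ H H) ∘L S.graph.subtypeL
  have hf : AntilipschitzWith ⟨max m⁻¹ 1, by positivity⟩ f := by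
    refine AddMonoidHomClass.antilipschitz_of_bound f fun p => ?_
    obtain ⟨⟨x, y⟩, hp⟩ := p
    obtain ⟨g, hg⟩ := LinearPMap.mem_graph_iff _ |>.1 hp
    obtain ⟨rfl, rfl⟩ := hg
    change max ‖(g : H)‖ ‖S g‖ ≤ max m⁻¹ 1 * ‖S g‖
    refine max_le ?_ ?_
    · have := hb g
      calc ‖(g : H)‖ ≤ m⁻¹ * ‖S g‖ := by rwa [le_inv_mul_iff₀ hm]
        _ ≤ _ := mul_le_mul_of_nonneg_right (le_max_left _ _) (norm_nonneg _)
    · calc ‖S g‖ = 1 * ‖S g‖ := (one_mul _).symm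
        _ ≤ _ := mul_le_mul_of_nonneg_right (le_max_right _ _) (norm_nonneg _)
  have hr := hf.isClosed_range f.uniformContinuous
  convert hr using 1
  ext y
  constructor
  · rintro ⟨g, rfl⟩
    exact ⟨⟨(g, S g), S.mem_graph g⟩, rfl⟩
  · rintro ⟨⟨⟨x, y⟩, hp⟩, rfl⟩
    obtain ⟨g, hg⟩ := LinearPMap.mem_graph_iff _ |>.1 hp
    exact ⟨g, hg.2⟩

end Restriction

/-! ### The reduced inverse -/

variable {H : Type*} [NormedAddCommGroup H] [InnerProductSpace ℂ H] [CompleteSpace H]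

/-- The orthogonal projection `P` onto the range of `S` together with the compact operator `G`
that inverts `S` on its range and vanishes on the orthogonal complement of the range. -/
structure ReducedInverse (S : H →ₗ.[ℂ] H) where
  P : H →L[ℂ] H
  G : H →L[ℂ] H
  mem_domain : ∀ x, G x ∈ S.domain
  apply_G : ∀ x, S ⟨G x, mem_domain x⟩ = P x
  G_apply : ∀ g : S.domain, G (S g) = g
  P_apply : ∀ g : S.domain, P (S g) = S g
  inner_P_left : ∀ x y, inner ℂ (P x) y = inner ℂ x (P y)
  isCompactOperator_G : IsCompactOperator G
  P_eq_zero_iff : ∀ x, P x = 0 ↔ x ∈ kernel S.adjoint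

theorem mem_kernel_adjoint_iff {S : H →ₗ.[ℂ] H} (hd : Dense (S.domain : Set H)) {x : H} :
    x ∈ kernel S.adjoint ↔ ∀ g : S.domain, inner ℂ x (S g) = 0 := by
  rw [mem_kernel_iff]
  constructor
  · rintro ⟨h, h0⟩ g
    have := LinearPMap.adjoint_isFormalAdjoint hd ⟨x, h⟩ g
    rw [← this, h0, inner_zero_left]
  · intro h
    have h1 : ∀ g : S.domain, inner ℂ (0 : H) (g : H) = inner ℂ x (S g) := fun g => by
      rw [h g, inner_zero_left]
    have h2 := LinearPMap.mem_adjoint_domain_of_exists x ⟨0, h1⟩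
    exact ⟨h2, LinearPMap.adjoint_apply_eq hd ⟨x, h2⟩ h1⟩

theorem nonempty_reducedInverse {S : H →ₗ.[ℂ] H} (hc : S.IsClosed)
    (hd : Dense (S.domain : Set H)) (hp : HasPositiveLowerBound S)
    (hcomp : IsCompactOperator (embedding S)) : Nonempty (ReducedInverse S) := by
  obtain ⟨m, hm, hb⟩ := hp.exists_norm_le
  have hclosed := isClosed_range_of_hasPositiveLowerBound hc hp
  set M := LinearMap.range S.toFun with hM
  have : CompleteSpace M := hclosed.completeSpace_coe
  have hinj : Function.Injective S.toFun := by
    rw [injective_iff_map_eq_zero]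
    intro f hf
    have h1 := hb f
    change m * ‖(f : H)‖ ≤ ‖S.toFun f‖ at h1
    rw [hf, norm_zero] at h1
    have h2 : ‖(f : H)‖ ≤ 0 := by
      by_contra h
      have := mul_pos hm (not_le.1 h)
      linarith
    exact Subtype.ext (norm_le_zero_iff.1 h2)
  let e : S.domain ≃ₗ[ℂ] M := LinearEquiv.ofInjective S.toFun hinj
  have he : ∀ y : M, S (e.symm y) = y := fun y => congrArg Subtype.val (e.apply_symm_apply y)
  let Q : H →L[ℂ] M := M.orthogonalProjectionOnto
  let G₁ : H →ₗ[ℂ] S.domain := e.symm.toLinearMap ∘ₗ Q.toLinearMap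
  have hG₁ : ∀ x, S (G₁ x) = Q x := fun x => he (Q x)
  have hQ : ∀ x, ‖Q x‖ ≤ ‖x‖ := M.norm_orthogonalProjectionOnto_apply_le
  let G : H →L[ℂ] H := (S.domain.subtype ∘ₗ G₁).mkContinuous m⁻¹ fun x => by
    rw [le_inv_mul_iff₀ hm]
    refine (hb (G₁ x)).trans ?_
    rw [hG₁]
    exact hQ x
  -- `G` factors through dom `S` in the norm `‖S f‖`: the first factor is a contraction because `S
  -- (G₁ x) = Q x`, the second is the compact embedding.
  let i : H →+ DomSpace S := G₁.toAddMonoidHom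
  have hi : Continuous i := by
    refine AddMonoidHomClass.continuous_of_bound i 1 fun x => ?_
    have : ‖i x‖ = ‖S (G₁ x)‖ := rfl
    rw [this, hG₁, one_mul]
    exact hQ x
  have hGc : IsCompactOperator G := by
    obtain ⟨K, hK, hKn⟩ := hcomp
    refine ⟨K, hK, ?_⟩
    have := hi.tendsto 0
    rw [map_zero] at this
    exact this hKn
  have hPS : ∀ g : S.domain, Q (S g) = e g := fun g =>
    M.orthogonalProjectionOnto_mem_subspace_eq_self (e g)
  refine ⟨⟨M.subtypeL ∘L Q, G, fun x => (G₁ x).2, hG₁, ?_, ?_, ?_, hGc, ?_⟩⟩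
  · intro g
    change ((e.symm (Q (S g)) : S.domain) : H) = g
    rw [hPS, e.symm_apply_apply]
  · intro g
    exact congrArg Subtype.val (hPS g)
  · intro x y
    exact M.inner_starProjection_left_eq_right x y
  · intro x
    rw [mem_kernel_adjoint_iff hd]
    change ((Q x : M) : H) = 0 ↔ _
    rw [Submodule.coe_eq_zero, Submodule.orthogonalProjectionOnto_eq_zero_iff,
      Submodule.mem_orthogonal']
    constructor
    · exact fun h g => h _ ⟨g, rfl⟩
    · rintro h _ ⟨g, rfl⟩
      exact h g

end KreinVN

/-! ### Spectrum of the Krein extension -/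

namespace KreinVN

variable {H : Type*} [NormedAddCommGroup H] [InnerProductSpace ℂ H] [CompleteSpace H]
  {S : H →ₗ.[ℂ] H}

section Krein

theorem kreinExtension_apply_of_add_eq (hd : Dense (S.domain : Set H))
    (hs : S.IsFormalAdjoint S)
    {g h x : H} (hg : g ∈ S.domain) (hh : h ∈ kernel S.adjoint) (hgh : g + h = x) :
    ∃ hx : x ∈ (kreinExtension S).domain, kreinExtension S ⟨x, hx⟩ = S ⟨g, hg⟩ := by
  subst hgh
  have hx : g + h ∈ (kreinExtension S).domain := by
    rw [kreinExtension_domain hd hs]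
    exact Submodule.add_mem_sup hg hh
  refine ⟨hx, ?_⟩
  obtain ⟨hh', h0⟩ := mem_kernel_iff.1 hh
  have hle := LinearPMap.IsFormalAdjoint.le_adjoint hd hs
  have h1 : kreinExtension S ⟨g + h, hx⟩ = S.adjoint (⟨g, hle.1 hg⟩ + ⟨h, hh'⟩) :=
    (kreinExtension_le_adjoint S).2 rfl
  rw [h1, LinearPMap.map_add, h0, add_zero]
  exact (hle.2 (x := ⟨g, hg⟩) (y := ⟨g, hle.1 hg⟩) rfl).symm

theorem exists_add_of_mem_kreinExtension_domain (hd : Dense (S.domain : Set H))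
    (hs : S.IsFormalAdjoint S) {x : H} (hx : x ∈ (kreinExtension S).domain) :
    ∃ g : S.domain, ∃ h ∈ kernel S.adjoint, (g : H) + h = x ∧
      kreinExtension S ⟨x, hx⟩ = S g := by
  have hx' := hx
  rw [kreinExtension_domain hd hs, Submodule.mem_sup] at hx'
  obtain ⟨g, hg, h, hh, rfl⟩ := hx'
  obtain ⟨_, h1⟩ := kreinExtension_apply_of_add_eq hd hs hg hh rfl
  exact ⟨⟨g, hg⟩, h, hh, rfl, h1⟩

end Krein

namespace ReducedInverse

/-- The compression of `G` to the range of `S`: the inverse of the Krein extension on the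
orthogonal complement of its kernel. -/
noncomputable def compression (R : ReducedInverse S) : H →L[ℂ] H := R.P ∘L R.G

theorem compression_apply (R : ReducedInverse S) (x : H) : R.compression x = R.P (R.G x) := rfl

theorem P_P (R : ReducedInverse S) (x : H) : R.P (R.P x) = R.P x := by
  rw [← R.apply_G x, R.P_apply]

theorem sub_P_mem_kernel (R : ReducedInverse S) (x : H) : x - R.P x ∈ kernel S.adjoint := by
  rw [← R.P_eq_zero_iff, map_sub, R.P_P, sub_self]

theorem isCompactOperator_compression (R : ReducedInverse S) : IsCompactOperator R.compression :=
  R.isCompactOperator_G.clm_comp R.P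

theorem inner_compression (R : ReducedInverse S) (x y : H) :
    inner ℂ x (R.compression y) = inner ℂ (S ⟨R.G x, R.mem_domain x⟩) (R.G y) := by
  rw [compression_apply, ← R.inner_P_left, ← R.apply_G]

theorem isSymmetric_compression (R : ReducedInverse S) (hs : S.IsFormalAdjoint S) :
    (R.compression : H →ₗ[ℂ] H).IsSymmetric := by
  intro x y
  change inner ℂ (R.compression x) y = inner ℂ x (R.compression y)
  rw [inner_compression, hs ⟨R.G x, R.mem_domain x⟩ ⟨R.G y, R.mem_domain y⟩, R.apply_G,
    compression_apply, R.inner_P_left]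

theorem inner_compression_nonneg (R : ReducedInverse S) (hp : HasPositiveLowerBound S) (x : H) :
    0 ≤ (inner ℂ x (R.compression x)).re := by
  obtain ⟨m, hm, h⟩ := hp
  rw [inner_compression]
  exact (by positivity : (0 : ℝ) ≤ _).trans (h ⟨R.G x, R.mem_domain x⟩)

theorem eigenspace_kreinExtension (R : ReducedInverse S) (hd : Dense (S.domain : Set H))
    (hs : S.IsFormalAdjoint S)
    {z : ℂ} (hz : z ≠ 0) : eigenspace (kreinExtension S) z =
      Module.End.eigenspace (R.compression : Module.End ℂ H) z⁻¹ := by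
  ext x
  rw [mem_eigenspace_iff, Module.End.mem_eigenspace_iff]
  change _ ↔ R.P (R.G x) = z⁻¹ • x
  constructor
  · rintro ⟨hx, hxz⟩
    obtain ⟨g, h, hh, rfl, h1⟩ := exists_add_of_mem_kreinExtension_domain hd hs hx
    rw [h1] at hxz
    have h2 : (g : H) + h = z⁻¹ • S g := by rw [hxz, inv_smul_smul₀ hz]
    have h3 : R.P ((g : H) + h) = (g : H) + h := by rw [h2, map_smul, R.P_apply]
    have h4 : R.P g = (g : H) + h := by
      rwa [map_add, (R.P_eq_zero_iff h).2 hh, add_zero] at h3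
    rw [h2, map_smul, R.G_apply, map_smul, h4, ← h2]
  · intro hx
    have h1 : R.P x = x := by
      have : x = z • R.P (R.G x) := by rw [hx, smul_inv_smul₀ hz]
      rw [this, map_smul, R.P_P]
    have h2 : S ⟨R.G x, R.mem_domain x⟩ = x := by rw [R.apply_G, h1]
    have h3 := R.sub_P_mem_kernel (R.G x)
    rw [hx] at h3
    -- The domain part of the eigenvector is `z G x`; what remains is a multiple of `G x - P (G x)`,
    -- which lies in the kernel of the adjoint.
    have h6 : z • R.G x + -(z • (R.G x - z⁻¹ • x)) = x := by
      rw [smul_sub, smul_inv_smul₀ hz]; abel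
    have h7 : S ⟨z • R.G x, S.domain.smul_mem z (R.mem_domain x)⟩ = z • x := by
      have := S.map_smul z ⟨R.G x, R.mem_domain x⟩
      rwa [h2] at this
    obtain ⟨h4, h5⟩ := kreinExtension_apply_of_add_eq hd hs
      (S.domain.smul_mem z (R.mem_domain x))
      ((kernel S.adjoint).neg_mem ((kernel S.adjoint).smul_mem z h3)) h6
    exact ⟨h4, h5.trans h7⟩

/-- To solve `(S_K - z)x = y` with `x = g + h`, put `u = S g`. Applying `P` gives `(1 - zB)u = P y`,
and `x = z⁻¹(u - y)`. By the Fredholm alternative `V = (1 - zB)⁻¹` exists, so the resolvent is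
`z⁻¹(V P - 1)`. -/
theorem mem_resolventSet_of_ne_zero (R : ReducedInverse S) (hd : Dense (S.domain : Set H))
    (hs : S.IsFormalAdjoint S)
    {z : ℂ} (hz : z ≠ 0) (h : eigenspace (kreinExtension S) z = ⊥) :
    z ∈ resolventSet (kreinExtension S) := by
  rw [R.eigenspace_kreinExtension hd hs hz] at h
  have hz' : z⁻¹ ≠ 0 := inv_ne_zero hz
  have hnot : z⁻¹ ∉ _root_.spectrum ℂ R.compression := by
    rw [← R.isCompactOperator_compression.hasEigenvalue_iff_mem_spectrum hz']
    exact fun hev => hev h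
  rw [spectrum.notMem_iff] at hnot
  obtain ⟨U, hU⟩ := hnot
  have hUl : ∀ x, (U : H →L[ℂ] H) x = z⁻¹ • x - R.compression x := fun x => by
    rw [hU]; simp [Algebra.algebraMap_eq_smul_one]
  set V : H →L[ℂ] H := z⁻¹ • (U⁻¹ : (H →L[ℂ] H)ˣ) with hV
  have hVl : ∀ x, V (x - z • R.compression x) = x := fun x => by
    have h1 : x - z • R.compression x = z • (U : H →L[ℂ] H) x := by
      rw [hUl, smul_sub, smul_inv_smul₀ hz]
    have h2 : ((U⁻¹ : (H →L[ℂ] H)ˣ) : H →L[ℂ] H) ((U : H →L[ℂ] H) x) = x := by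
      rw [← mul_apply_eq_comp, U.inv_mul, one_apply_eq_self]
    rw [h1, map_smul, hV, smul_apply, h2, smul_inv_smul₀ hz]
  have hVr : ∀ x, V x - z • R.compression (V x) = x := fun x => by
    have h1 : V x - z • R.compression (V x) = z • (U : H →L[ℂ] H) (V x) := by
      rw [hUl, smul_sub, smul_inv_smul₀ hz]
    have h2 : (U : H →L[ℂ] H) (((U⁻¹ : (H →L[ℂ] H)ˣ) : H →L[ℂ] H) x) = x := by
      rw [← mul_apply_eq_comp, U.mul_inv, one_apply_eq_self]
    rw [h1, hV, smul_apply, map_smul, h2, smul_inv_smul₀ hz]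
  refine ⟨z⁻¹ • (V ∘L R.P - ContinuousLinearMap.id ℂ H), fun y => ?_, fun x => ?_⟩
  · change ∃ hy : z⁻¹ • (V (R.P y) - y) ∈ (kreinExtension S).domain,
      kreinExtension S ⟨z⁻¹ • (V (R.P y) - y), hy⟩ - z • z⁻¹ • (V (R.P y) - y) = y
    set u := V (R.P y) with hu
    have h1 : u - z • R.compression u = R.P y := hVr _
    have h2 : u = R.P y + z • R.compression u := by rw [← h1]; abel
    have h3 : R.P u = u := by
      rw [h2, map_add, map_smul, compression_apply, R.P_P, R.P_P, ← compression_apply, ← h2]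
    have hk : -(R.G u - R.P (R.G u)) + -(z⁻¹ • (y - R.P y)) ∈ kernel S.adjoint :=
      Submodule.add_mem _ (Submodule.neg_mem _ (R.sub_P_mem_kernel _))
        (Submodule.neg_mem _ (Submodule.smul_mem _ _ (R.sub_P_mem_kernel _)))
    -- This splits the candidate solution into a part in dom `S` and a part in the kernel of the
    -- adjoint.
    have h6 : R.G u + (-(R.G u - R.P (R.G u)) + -(z⁻¹ • (y - R.P y))) = z⁻¹ • (u - y) := by
      have : R.P (R.G u) = z⁻¹ • (u - R.P y) := by
        rw [← compression_apply, ← h1, sub_sub_cancel, inv_smul_smul₀ hz]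
      rw [this]
      simp only [smul_sub]
      abel
    obtain ⟨h4, h5⟩ := kreinExtension_apply_of_add_eq hd hs (R.mem_domain u) hk h6
    rw [R.apply_G, h3] at h5
    refine ⟨h4, ?_⟩
    rw [h5, smul_inv_smul₀ hz, sub_sub_cancel]
  · obtain ⟨x, hx⟩ := x
    obtain ⟨g, h, hh, rfl, h1⟩ := exists_add_of_mem_kreinExtension_domain hd hs hx
    rw [h1]
    change z⁻¹ • (V (R.P (S g - z • ((g : H) + h))) - (S g - z • ((g : H) + h))) = (g : H) + h
    have h2 : R.P (S g - z • ((g : H) + h)) = S g - z • R.compression (S g) := by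
      rw [map_sub, R.P_apply, map_smul, map_add, (R.P_eq_zero_iff h).2 hh, add_zero,
        compression_apply, R.G_apply]
    rw [h2, hVl, sub_sub_cancel, inv_smul_smul₀ hz]

/-- The null space of the Krein extension contains ker `S*`. If it is trivial then `P = 1`, and `G`
is a genuine inverse. -/
theorem zero_mem_resolventSet (R : ReducedInverse S) (hd : Dense (S.domain : Set H))
    (hs : S.IsFormalAdjoint S)
    (h : eigenspace (kreinExtension S) 0 = ⊥) : (0 : ℂ) ∈ resolventSet (kreinExtension S) := by
  have hker : ∀ x ∈ kernel S.adjoint, x = 0 := by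
    intro x hx
    obtain ⟨h1, h2⟩ := kreinExtension_apply_of_add_eq hd hs S.domain.zero_mem hx (zero_add x)
    have h3 : x ∈ eigenspace (kreinExtension S) 0 := by
      rw [mem_eigenspace_iff]
      exact ⟨h1, by rw [h2, zero_smul]; exact S.map_zero⟩
    rw [h, Submodule.mem_bot] at h3
    exact h3
  have hP : ∀ x, R.P x = x := fun x => (sub_eq_zero.1 (hker _ (R.sub_P_mem_kernel x))).symm
  refine ⟨R.G, fun y => ?_, fun x => ?_⟩
  · obtain ⟨h1, h2⟩ := kreinExtension_apply_of_add_eq hd hs (R.mem_domain y)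
      (kernel S.adjoint).zero_mem (add_zero _)
    rw [R.apply_G, hP] at h2
    exact ⟨h1, by rw [zero_smul, sub_zero, h2]⟩
  · obtain ⟨x, hx⟩ := x
    obtain ⟨g, k, hk, rfl, h1⟩ := exists_add_of_mem_kreinExtension_domain hd hs hx
    have h2 : (g : H) = g + k := by rw [hker k hk, add_zero]
    rw [h1, zero_smul, sub_zero, R.G_apply]
    exact h2

theorem eigenspace_ne_bot_of_mem_spectrum (R : ReducedInverse S) (hd : Dense (S.domain : Set H))
    (hs : S.IsFormalAdjoint S) {z : ℂ} (hz : z ∈ spectrum (kreinExtension S)) :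
    eigenspace (kreinExtension S) z ≠ ⊥ := by
  intro h
  by_cases hz0 : z = 0
  · subst hz0
    exact hz (R.zero_mem_resolventSet hd hs h)
  · exact hz (R.mem_resolventSet_of_ne_zero hd hs hz0 h)

theorem finrank_eigenspace_kreinExtension (R : ReducedInverse S) (hd : Dense (S.domain : Set H))
    (hs : S.IsFormalAdjoint S) {s : ℝ} (hz : 0 < s) :
    Module.finrank ℂ (eigenspace (kreinExtension S) (s : ℂ)) = Module.finrank ℂ
      (Module.End.eigenspace (R.compression : Module.End ℂ H) ((s : ℂ)⁻¹)) := by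
  rw [R.eigenspace_kreinExtension hd hs (by exact_mod_cast hz.ne')]

theorem finiteDimensional_eigenspace_kreinExtension (R : ReducedInverse S)
    (hd : Dense (S.domain : Set H))
    (hs : S.IsFormalAdjoint S) {s : ℝ} (hz : 0 < s) :
    FiniteDimensional ℂ (eigenspace (kreinExtension S) (s : ℂ)) := by
  rw [R.eigenspace_kreinExtension hd hs (by exact_mod_cast hz.ne')]
  exact finiteDimensional_eigenspace_inv (R.isSymmetric_compression hs)
    R.isCompactOperator_compression hz

/-- A nonzero point of the spectrum of the Krein extension is a positive real number. -/
theorem exists_pos_eq_of_mem_spectrum (R : ReducedInverse S) (hd : Dense (S.domain : Set H))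
    (hs : S.IsFormalAdjoint S)
    (hp : HasPositiveLowerBound S) {z : ℂ} (hz : z ∈ spectrum (kreinExtension S)) (hz0 : z ≠ 0) :
    ∃ s : ℝ, 0 < s ∧ (s : ℂ) = z ∧ Module.finrank ℂ
      (Module.End.eigenspace (R.compression : Module.End ℂ H) ((s : ℂ)⁻¹)) ≠ 0 := by
  have h := R.eigenspace_ne_bot_of_mem_spectrum hd hs hz
  rw [R.eigenspace_kreinExtension hd hs hz0] at h
  have hev : Module.End.HasEigenvalue (R.compression : Module.End ℂ H) z⁻¹ := h
  have hsym := R.isSymmetric_compression hs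
  have hreal : (((z⁻¹).re : ℝ) : ℂ) = z⁻¹ :=
    Complex.conj_eq_iff_re.1 (hsym.conj_eigenvalue_eq_self hev)
  have hnn : 0 ≤ (z⁻¹).re := by
    rw [← hreal] at hev
    exact eigenvalue_nonneg_of_nonneg hev (R.inner_compression_nonneg hp)
  have hne : (z⁻¹).re ≠ 0 := fun h0 => by
    rw [h0, Complex.ofReal_zero] at hreal
    exact inv_ne_zero hz0 hreal.symm
  have hpos : 0 < (z⁻¹).re := lt_of_le_of_ne hnn hne.symm
  have heq : ((((z⁻¹).re)⁻¹ : ℝ) : ℂ) = z := by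
    rw [Complex.ofReal_inv, hreal, inv_inv]
  refine ⟨((z⁻¹).re)⁻¹, inv_pos.2 hpos, heq, ?_⟩
  have := finiteDimensional_eigenspace_inv hsym R.isCompactOperator_compression (inv_pos.2 hpos)
  intro h0
  rw [Submodule.finrank_eq_zero, heq] at h0
  exact h h0

theorem hasDiscreteNonnegSpectrum (R : ReducedInverse S) (hd : Dense (S.domain : Set H))
    (hs : S.IsFormalAdjoint S)
    (hp : HasPositiveLowerBound S) : HasDiscreteNonnegSpectrum (kreinExtension S) := by
  refine ⟨fun z hz => ?_, fun z hz => ?_, fun z hz => R.eigenspace_ne_bot_of_mem_spectrum hd hs hz,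
    fun r hr => R.finiteDimensional_eigenspace_kreinExtension hd hs hr⟩
  · by_cases hz0 : z = 0
    · simp [hz0]
    obtain ⟨s, hs0, rfl, -⟩ := R.exists_pos_eq_of_mem_spectrum hd hs hp hz hz0
    simp [hs0.le]
  · have hfin := finite_support_finrank_eigenspace_inv (R.isSymmetric_compression hs)
      R.isCompactOperator_compression (‖z‖ + 1)
    -- A finite set containing all spectrum in the ball of radius `‖z‖ + 1`; removing its points
    -- other than `z` isolates `z`. The point `0` is added by hand, as it may or may not be
    -- spectral.
    set F : Set ℂ := insert 0 (Complex.ofReal '' (Set.Ioc 0 (‖z‖ + 1) ∩ Function.support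
      fun s : ℝ => Module.finrank ℂ
        (Module.End.eigenspace (R.compression : Module.End ℂ H) ((s : ℂ)⁻¹)))) with hF
    have hFfin : (F \ {z}).Finite := ((hfin.image _).insert 0).subset Set.sdiff_subset
    refine ⟨Metric.ball 0 (‖z‖ + 1) ∩ (F \ {z})ᶜ, ?_, ?_⟩
    · refine (Metric.isOpen_ball.inter hFfin.isClosed.isOpen_compl).mem_nhds ⟨?_, ?_⟩
      · rw [mem_ball_zero_iff]; exact lt_add_one _
      · simp
    · ext w
      constructor
      · rintro ⟨⟨hw1, hw2⟩, hw3⟩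
        by_contra hwz
        refine hw2 ⟨?_, hwz⟩
        by_cases hw0 : w = 0
        · exact .inl hw0
        obtain ⟨s, hs0, rfl, hsne⟩ := R.exists_pos_eq_of_mem_spectrum hd hs hp hw3 hw0
        rw [mem_ball_zero_iff, Complex.norm_real, Real.norm_of_nonneg hs0.le] at hw1
        exact .inr ⟨s, ⟨⟨hs0, hw1.le⟩, hsne⟩, rfl⟩
      · rintro rfl
        refine ⟨⟨?_, ?_⟩, hz⟩
        · rw [mem_ball_zero_iff]; exact lt_add_one _
        · simp

end ReducedInverse

end KreinVN

/-! ### Variational principle and comparison -/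

namespace KreinVN

variable {H : Type*} [NormedAddCommGroup H] [InnerProductSpace ℂ H] [CompleteSpace H]
  {S : H →ₗ.[ℂ] H}

namespace ReducedInverse

/-- If `F` were larger, some nonzero `g` in `F` would have `S g` orthogonal to the eigenspan, where
`(u, B u) < r⁻¹‖u‖²`. For `u = S g` this contradicts the assumption on `F`. -/
theorem finrank_le_upperEigenspan (R : ReducedInverse S) (hs : S.IsFormalAdjoint S)
    (hp : HasPositiveLowerBound S) {r : ℝ} (hr : 0 < r) {F : Submodule ℂ H}
    [FiniteDimensional ℂ F] (hF : F ≤ S.domain)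
    (hq : ∀ g (hg : g ∈ F), ‖S ⟨g, hF hg⟩‖ ^ 2 ≤ r * (inner ℂ (S ⟨g, hF hg⟩) g).re) :
    Module.finrank ℂ F ≤ Module.finrank ℂ (upperEigenspan R.compression r) := by
  have hsym := R.isSymmetric_compression hs
  have hfin := finiteDimensional_upperEigenspan hsym R.isCompactOperator_compression r
  set E := upperEigenspan R.compression r
  by_contra! hlt
  let f : F →ₗ[ℂ] E :=
    E.orthogonalProjectionOnto.toLinearMap ∘ₗ S.toFun ∘ₗ Submodule.inclusion hF
  obtain ⟨g, hg, hg0⟩ := (Submodule.ne_bot_iff _).1 (f.ker_ne_bot_of_finrank_lt hlt)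
  let g' : S.domain := Submodule.inclusion hF g
  have hu : S g' ∈ Eᗮ := Submodule.orthogonalProjectionOnto_eq_zero_iff.1 hg
  have hu0 : S g' ≠ 0 := fun h => by
    have h1 := R.G_apply g'
    rw [h, map_zero] at h1
    exact hg0 (Subtype.ext h1.symm)
  have h1 := inner_lt_inv_mul_norm_sq_of_mem_orthogonal hsym R.isCompactOperator_compression
    (R.inner_compression_nonneg hp) hr hu hu0
  rw [compression_apply, R.G_apply, ← R.inner_P_left, R.P_apply, lt_inv_mul_iff₀ hr] at h1
  exact absurd (hq g g.2) (not_le.2 h1)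

/-- The extremal subspace is the preimage under `S` of the eigenspan, that is, its image under `G`;
the eigenspan lies in ran `S`. -/
theorem exists_finrank_eq_upperEigenspan (R : ReducedInverse S) (hs : S.IsFormalAdjoint S)
    {r : ℝ} (hr : 0 < r) : ∃ F : Submodule ℂ H, ∃ hF : F ≤ S.domain, FiniteDimensional ℂ F ∧
      Module.finrank ℂ F = Module.finrank ℂ (upperEigenspan R.compression r) ∧
      ∀ g (hg : g ∈ F), ‖S ⟨g, hF hg⟩‖ ^ 2 ≤ r * (inner ℂ (S ⟨g, hF hg⟩) g).re := by
  have hsym := R.isSymmetric_compression hs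
  have hfin := finiteDimensional_upperEigenspan hsym R.isCompactOperator_compression r
  have hP : ∀ u ∈ upperEigenspan R.compression r, R.P u = u := by
    have hle : upperEigenspan R.compression r ≤
        LinearMap.eqLocus R.P.toLinearMap LinearMap.id := by
      refine iSup_le fun s x hx => ?_
      have hx' : R.P (R.G x) = ((s : ℝ) : ℂ)⁻¹ • x := Module.End.mem_eigenspace_iff.1 hx
      have hs0 : ((s : ℝ) : ℂ) ≠ 0 := by exact_mod_cast s.2.1.ne'
      have h1 : x = ((s : ℝ) : ℂ) • R.P (R.G x) := by rw [hx', smul_inv_smul₀ hs0]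
      change R.P x = x
      rw [h1, map_smul, R.P_P]
    exact hle
  let f : upperEigenspan R.compression r →ₗ[ℂ] H :=
    R.G.toLinearMap ∘ₗ (upperEigenspan R.compression r).subtype
  have hSf : ∀ u, S ⟨f u, R.mem_domain u⟩ = u := fun u => (R.apply_G u).trans (hP u u.2)
  have hinj : Function.Injective f := by
    intro u v huv
    refine Subtype.ext ?_
    rw [← hSf u, ← hSf v]
    exact congrArg S (Subtype.ext huv)
  refine ⟨LinearMap.range f, ?_, inferInstance, LinearMap.finrank_range_of_inj hinj, ?_⟩
  · rintro _ ⟨u, rfl⟩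
    exact R.mem_domain u
  · rintro _ ⟨u, rfl⟩
    have h1 := inv_mul_norm_sq_le_of_mem_upperEigenspan hsym u.2
    rw [R.inner_compression, inv_mul_le_iff₀ hr] at h1
    refine le_of_eq_of_le ?_ h1
    rw [hSf]

/-- A dense domain in an infinite-dimensional space has subspaces of every finite dimension, and on
each of them `S` is bounded, so the lower bound makes it a test space for large `r`. -/
theorem exists_le_finrank_upperEigenspan (R : ReducedInverse S) (hd : Dense (S.domain : Set H))
    (hs : S.IsFormalAdjoint S) (hp : HasPositiveLowerBound S) (hH : ¬ FiniteDimensional ℂ H)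
    (n : ℕ) : ∃ r : ℝ, 0 < r ∧ n ≤ Module.finrank ℂ (upperEigenspan R.compression r) := by
  have hdom : ¬ FiniteDimensional ℂ S.domain := by
    intro h
    have h1 : S.domain = ⊤ := by
      have h2 := hd.closure_eq
      rw [S.domain.closed_of_finiteDimensional.closure_eq] at h2
      exact SetLike.coe_injective h2
    rw [h1] at h
    exact hH (Module.Finite.equiv Submodule.topEquiv)
  have hrank : (n : Cardinal) ≤ Module.rank ℂ S.domain := by
    refine (Cardinal.natCast_lt_aleph0).le.trans ?_
    rw [← not_lt]
    exact fun h => hdom (Module.rank_lt_aleph0_iff.1 h)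
  obtain ⟨t, htn, ht⟩ := le_rank_iff_exists_linearIndependent_finset.1 hrank
  let F₀ : Submodule ℂ S.domain := Submodule.span ℂ (t : Set S.domain)
  have hF₀ : FiniteDimensional ℂ F₀ := FiniteDimensional.span_finset ℂ t
  have hn : Module.finrank ℂ F₀ = n := by rw [finrank_span_finset_eq_card ht, htn]
  let F : Submodule ℂ H := F₀.map S.domain.subtype
  have hF : F ≤ S.domain := Submodule.map_subtype_le _ _
  have hFn : Module.finrank ℂ F = n := by rw [Submodule.finrank_map_subtype_eq, hn]
  obtain ⟨m, hm, hb⟩ := hp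
  let f : F →L[ℂ] H := LinearMap.toContinuousLinearMap (S.toFun ∘ₗ Submodule.inclusion hF)
  -- The summand `1` keeps the threshold positive when `f = 0`.
  have hr : 0 < ‖f‖ ^ 2 * m⁻¹ + 1 := by positivity
  refine ⟨‖f‖ ^ 2 * m⁻¹ + 1, hr, ?_⟩
  rw [← hFn]
  refine R.finrank_le_upperEigenspan hs ⟨m, hm, hb⟩ hr hF fun g hg => ?_
  have h1 : ‖S ⟨g, hF hg⟩‖ ≤ ‖f‖ * ‖g‖ := f.le_opNorm ⟨g, hg⟩
  have h2 : m * ‖g‖ ^ 2 ≤ (inner ℂ (S ⟨g, hF hg⟩) g).re := hb ⟨g, hF hg⟩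
  have h3 : 0 ≤ (inner ℂ (S ⟨g, hF hg⟩) g).re := (by positivity : (0 : ℝ) ≤ _).trans h2
  calc ‖S ⟨g, hF hg⟩‖ ^ 2 ≤ (‖f‖ * ‖g‖) ^ 2 := pow_le_pow_left₀ (norm_nonneg _) h1 2
    _ = ‖f‖ ^ 2 * m⁻¹ * (m * ‖g‖ ^ 2) := by field_simp
    _ ≤ ‖f‖ ^ 2 * m⁻¹ * (inner ℂ (S ⟨g, hF hg⟩) g).re :=
        mul_le_mul_of_nonneg_left h2 (by positivity)
    _ ≤ _ := by rw [add_mul, one_mul]; exact le_add_of_nonneg_right h3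

variable {T : H →ₗ.[ℂ] H}

theorem finrank_upperEigenspan_mono (R : ReducedInverse S) (Q : ReducedInverse T)
    (hST : S ≤ T) (hs : S.IsFormalAdjoint S) (ht : T.IsFormalAdjoint T)
    (hp : HasPositiveLowerBound T) {r : ℝ} (hr : 0 < r) :
    Module.finrank ℂ (upperEigenspan R.compression r) ≤
      Module.finrank ℂ (upperEigenspan Q.compression r) := by
  obtain ⟨F, hF, _, hdim, hq⟩ := R.exists_finrank_eq_upperEigenspan hs hr
  rw [← hdim]
  refine Q.finrank_le_upperEigenspan ht hp hr (hF.trans hST.1) fun g hg => ?_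
  rw [← hST.2 (x := ⟨g, hF hg⟩) (y := ⟨g, hST.1 (hF hg)⟩) rfl]
  exact hq g hg

theorem finrank_upperEigenspan_le_add (R : ReducedInverse S) (Q : ReducedInverse T)
    (hST : S ≤ T) (hs : S.IsFormalAdjoint S) (ht : T.IsFormalAdjoint T)
    (hp : HasPositiveLowerBound S) {k : ℕ}
    (hk : Module.rank ℂ (T.domain ⧸ S.domain.submoduleOf T.domain) = k) {r : ℝ} (hr : 0 < r) :
    Module.finrank ℂ (upperEigenspan Q.compression r) ≤
      Module.finrank ℂ (upperEigenspan R.compression r) + k := by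
  obtain ⟨F, hF, _, hdim, hq⟩ := Q.exists_finrank_eq_upperEigenspan ht hr
  rw [← hdim]
  have hquot : FiniteDimensional ℂ (T.domain ⧸ S.domain.submoduleOf T.domain) :=
    Module.rank_lt_aleph0_iff.1 (hk ▸ Cardinal.natCast_lt_aleph0)
  let f : F →ₗ[ℂ] T.domain ⧸ S.domain.submoduleOf T.domain :=
    (S.domain.submoduleOf T.domain).mkQ ∘ₗ Submodule.inclusion hF
  -- `K` is the part of the test space `F` inside dom `S`; it loses at most `k` dimensions, by
  -- rank–nullity.
  let K : Submodule ℂ H := (LinearMap.ker f).map F.subtype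
  have hKF : K ≤ F := Submodule.map_subtype_le _ _
  have hKS : K ≤ S.domain := by
    rintro _ ⟨x, hx, rfl⟩
    exact (Submodule.Quotient.mk_eq_zero (S.domain.submoduleOf T.domain)
      (x := Submodule.inclusion hF x)).1 hx
  have h1 := f.finrank_range_add_finrank_ker
  have h2 : Module.finrank ℂ (LinearMap.range f) ≤ k := by
    rw [← Module.finrank_eq_of_rank_eq hk]
    exact Submodule.finrank_le _
  have h3 : Module.finrank ℂ K ≤ Module.finrank ℂ (upperEigenspan R.compression r) := by
    refine R.finrank_le_upperEigenspan hs hp hr hKS fun g hg => ?_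
    rw [hST.2 (x := ⟨g, hKS hg⟩) (y := ⟨g, hF (hKF hg)⟩) rfl]
    exact hq g (hKF hg)
  rw [Submodule.finrank_map_subtype_eq] at h3
  omega

/-- The multiplicity of `s` as an eigenvalue of the Krein extension, in terms of the compression. -/
noncomputable def mult (R : ReducedInverse S) (s : ℝ) : ℕ :=
  Module.finrank ℂ (Module.End.eigenspace (R.compression : Module.End ℂ H) ((s : ℂ)⁻¹))

theorem finite_support_mult (R : ReducedInverse S) (hs : S.IsFormalAdjoint S) (r : ℝ) :
    (Set.Ioc 0 r ∩ R.mult.support).Finite :=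
  finite_support_finrank_eigenspace_inv (R.isSymmetric_compression hs)
    R.isCompactOperator_compression r

theorem posCount_mult (R : ReducedInverse S) (hs : S.IsFormalAdjoint S) (r : ℝ) :
    posCount R.mult r = Module.finrank ℂ (upperEigenspan R.compression r) :=
  posCount_finrank_eigenspace_inv (R.isSymmetric_compression hs)
    R.isCompactOperator_compression r

theorem toENat_rank_eigenspace (R : ReducedInverse S) (hd : Dense (S.domain : Set H))
    (hs : S.IsFormalAdjoint S) {s : ℝ} (hs0 : 0 < s) :
    Cardinal.toENat (Module.rank ℂ (eigenspace (kreinExtension S) (s : ℂ))) = R.mult s := by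
  have := R.finiteDimensional_eigenspace_kreinExtension hd hs hs0
  rw [mult, ← R.finrank_eigenspace_kreinExtension hd hs hs0, ← Module.finrank_eq_rank,
    Cardinal.toENat_nat]

theorem exists_isPosEigenvalueSeq (R : ReducedInverse S) (hd : Dense (S.domain : Set H))
    (hs : S.IsFormalAdjoint S) (hp : HasPositiveLowerBound S) :
    ∃ lam : ℕ → EReal, IsPosEigenvalueSeq (kreinExtension S) lam ∧
      (¬ FiniteDimensional ℂ H → ∀ j, lam j ≠ ⊤) := by
  have hfin := R.finite_support_mult hs
  obtain ⟨lam, hmono, hpos, hmul⟩ := exists_monotone_list hfin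
  refine ⟨lam, ⟨hmono, hpos, fun r hr => ?_⟩, fun hH j htop => ?_⟩
  · rw [hmul r hr, R.toENat_rank_eigenspace hd hs hr]
  · obtain ⟨r, -, hr⟩ := R.exists_le_finrank_upperEigenspan hd hs hp hH (j + 1)
    rw [← R.posCount_mult hs] at hr
    have := (lt_posCount_of_le hfin hmono hpos hmul r j).2 hr
    rw [htop, top_le_iff] at this
    exact EReal.coe_ne_top r this

theorem le_shift_of_finrank_le (R : ReducedInverse S) (Q : ReducedInverse T)
    (hdS : Dense (S.domain : Set H)) (hs : S.IsFormalAdjoint S)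
    (hdT : Dense (T.domain : Set H)) (ht : T.IsFormalAdjoint T) {lamS lamT : ℕ → EReal}
    (hS : IsPosEigenvalueSeq (kreinExtension S) lamS)
    (hT : IsPosEigenvalueSeq (kreinExtension T) lamT) {k : ℕ}
    (hk : ∀ r : ℝ, 0 < r → Module.finrank ℂ (upperEigenspan Q.compression r) ≤
      Module.finrank ℂ (upperEigenspan R.compression r) + k) (j : ℕ) :
    lamS j ≤ lamT (j + k) := by
  refine le_shift_of_posCount_le (R.finite_support_mult hs) (Q.finite_support_mult ht)
    hS.mono hS.pos (fun r hr => ?_) hT.mono hT.pos (fun r hr => ?_) (fun r hr => ?_) j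
  · rw [hS.multiplicity r hr, R.toENat_rank_eigenspace hdS hs hr]
  · rw [hT.multiplicity r hr, Q.toENat_rank_eigenspace hdT ht hr]
  · rw [R.posCount_mult hs, Q.posCount_mult ht]
    exact hk r hr

end ReducedInverse

end KreinVN

/-! ### The main theorem -/

theorem theorem2p6 {H : Type*} [NormedAddCommGroup H] [InnerProductSpace ℂ H] [CompleteSpace H]
    [TopologicalSpace.SeparableSpace H] (S T : H →ₗ.[ℂ] H)
    (hS_closed : S.IsClosed) (hS_dense : Dense (S.domain : Set H)) (hS_symm : S.IsFormalAdjoint S)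
    (hT_closed : T.IsClosed) (hT_dense : Dense (T.domain : Set H)) (hT_symm : T.IsFormalAdjoint T)
    (hST : S ≤ T) (hT_pos : KreinVN.HasPositiveLowerBound T)
    (hT_compact : IsCompactOperator (KreinVN.embedding T)) :
    KreinVN.HasDiscreteNonnegSpectrum (KreinVN.kreinExtension S) ∧
    KreinVN.HasDiscreteNonnegSpectrum (KreinVN.kreinExtension T) ∧
    (∃ lamS : ℕ → EReal, KreinVN.IsPosEigenvalueSeq (KreinVN.kreinExtension S) lamS ∧
      (¬ FiniteDimensional ℂ H → ∀ j, lamS j ≠ ⊤)) ∧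
    (∃ lamT : ℕ → EReal, KreinVN.IsPosEigenvalueSeq (KreinVN.kreinExtension T) lamT ∧
      (¬ FiniteDimensional ℂ H → ∀ j, lamT j ≠ ⊤)) ∧
    ∀ k : ℕ, Module.rank ℂ (T.domain ⧸ S.domain.submoduleOf T.domain) = k →
      ∀ lamS lamT : ℕ → EReal,
        KreinVN.IsPosEigenvalueSeq (KreinVN.kreinExtension S) lamS →
        KreinVN.IsPosEigenvalueSeq (KreinVN.kreinExtension T) lamT →
        ∀ j : ℕ, lamT j ≤ lamS j ∧ lamS j ≤ lamT (j + k) ∧ lamT (j + k) ≤ lamS (j + k) := by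

  have hS_pos := hT_pos.mono hST
  obtain ⟨R⟩ := KreinVN.nonempty_reducedInverse hS_closed hS_dense hS_pos
    (KreinVN.isCompactOperator_embedding_mono hST hT_compact)
  obtain ⟨Q⟩ := KreinVN.nonempty_reducedInverse hT_closed hT_dense hT_pos hT_compact
  refine ⟨R.hasDiscreteNonnegSpectrum hS_dense hS_symm hS_pos,
    Q.hasDiscreteNonnegSpectrum hT_dense hT_symm hT_pos,
    R.exists_isPosEigenvalueSeq hS_dense hS_symm hS_pos,
    Q.exists_isPosEigenvalueSeq hT_dense hT_symm hT_pos, fun k hk lamS lamT hS hT j => ?_⟩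
  -- The roles of `S` and `T` are exchanged and the shift is zero: `T` has at least as many
  -- eigenvalues up to each `r`.
  have hle : ∀ i, lamT i ≤ lamS i := fun i =>
    Q.le_shift_of_finrank_le R hT_dense hT_symm hS_dense hS_symm hT hS (k := 0)
      (fun r hr => R.finrank_upperEigenspan_mono Q hST hS_symm hT_symm hT_pos hr) i
  exact ⟨hle j, R.le_shift_of_finrank_le Q hS_dense hS_symm hT_dense hT_symm hS hT
    (fun r hr => R.finrank_upperEigenspan_le_add Q hST hS_symm hT_symm hS_pos hk hr) j,
    hle (j + k)⟩
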